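/- For real numbers $h>0$ and $p$ let $K(h,p)$ denote the generalized Kantorovich constant $$K(h,p)=\frac{h^p-h}{(p-1)(h-1)}\left(\frac{p-1}{p}\,\frac{h^p-1}{h^p-h}\right)^p ,$$ where $K(h,0)=K(h,1)=K(1,p)=1$. Let $0<m<M$ be real numbers and $h=M/m$. Let $A,B$ be positive definite complex $k\times k$ matrices with $mI\le A\le MI$ and $mI\le B\le MI$ in the Loewner order, and let $\Phi:\mathbb{M}_k(\mathbb{C})\to\mathbb{M}_n(\mathbb{C})$ be a unital positive linear map (that is, $\Phi(I)=I$ and $\Phi(X)\ge 0$ whenever $X\ge 0$). Then $$K(h,p)^{1/p}\left(\mathrm{Tr}\big[\Phi(A^p)^{1/p}\big]+\mathrm{Tr}\big[\Phi(B^p)^{1/p}\big]\right)\le \mathrm{Tr}\big[\Phi((A+B)^p)^{1/p}\big]\le K(h,p)^{-1/p}\left(\mathrm{Tr}\big[\Phi(A^p)^{1/p}\big]+\mathrm{Tr}\big[\Phi(B^p)^{1/p}\big]\right)$$ for all real $p$ with $p<0$ or $0<p\le 1$, and $$K(h,p)^{-1/p}\left(\mathrm{Tr}\big[\Phi(A^p)^{1/p}\big]+\mathrm{Tr}\big[\Phi(B^p)^{1/p}\big]\right)\le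 \mathrm{Tr}\big[\Phi((A+B)^p)^{1/p}\big]\le K(h,p)^{1/p}\left(\mathrm{Tr}\big[\Phi(A^p)^{1/p}\big]+\mathrm{Tr}\big[\Phi(B^p)^{1/p}\big]\right)$$ for all real $p\ge 1$. Here real powers of positive definite matrices are defined by the functional calculus. -/

import Mathlib

open scoped MatrixOrder ComplexOrder

/-- The generalized Kantorovich constant `K(h, p)` for `h > 0` and real `p`. At the points where the
closed formula has the form `0 / 0`, that is `h = 1`, `p = 0` and `p = 1`, it takes its limit
value `1`. -/
noncomputable def genKantorovich (h p : ℝ) : ℝ :=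
  if h = 1 ∨ p = 0 ∨ p = 1 then 1
  else (h ^ p - h) / ((p - 1) * (h - 1)) *
    ((p - 1) / p * ((h ^ p - 1) / (h ^ p - h))) ^ p

/-! The bridge is the linear quantity Tr Φ(A): up to the factor K^(1/p) it equals Tr Φ(A^p)^(1/p),
on one side exactly, and it is additive in A. Since A + B lies between 2m and 2M, it has the same
ratio h, so comparing A, B and A + B with their linear traces gives all four bounds. The comparison
is scalar. In an eigenbasis of Φ(A^p), both traces become sums of weighted means of the eigenvalues
of A (`exists_weights_trace_map_rpow`), so Jensen and its Kantorovich converse apply row by row.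
Both follow from Bernoulli; the factor p(p-1), with the sign of the second derivative of t^p, treats
convex and concave exponents together. -/

/-! ### Scalar power inequalities -/

/-- Bernoulli's inequality for all real exponents: the sign of `x ^ p - (1 + p * (x - 1))` is that
of `p * (p - 1)`. -/
theorem bernoulli_signed (p : ℝ) {x : ℝ} (hx : 0 < x) :
    0 ≤ p * (p - 1) * (x ^ p - 1 - p * (x - 1)) := by
  rcases le_or_gt 1 p with h1 | h1
  · have := one_add_mul_self_le_rpow_one_add (s := x - 1) (by linarith) h1
    rw [add_sub_cancel] at this
    exact mul_nonneg (mul_nonneg (by linarith) (by linarith)) (by linarith)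
  rcases le_or_gt 0 p with h0 | h0
  · have := rpow_one_add_le_one_add_mul_self (s := x - 1) (by linarith) h0 h1.le
    rw [add_sub_cancel] at this
    exact mul_nonneg_of_nonpos_of_nonpos (mul_nonpos_of_nonneg_of_nonpos h0 (by linarith))
      (by linarith)
  · have hq : 0 < 1 - p := by linarith
    -- For p < 0, use exponent 1/(1-p) in (0, 1] on x^(p-1): the power is 1/x, and multiplying by
    -- (1-p)x gives the claim.
    have key := rpow_one_add_le_one_add_mul_self (s := x ^ (p - 1) - 1)
      (by linarith [Real.rpow_pos_of_pos hx (p - 1)]) (p := (1 - p)⁻¹) (by positivity)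
      (inv_le_one_of_one_le₀ (by linarith))
    rw [add_sub_cancel, ← Real.rpow_mul hx.le,
      show (p - 1) * (1 - p)⁻¹ = -1 by field_simp; ring, Real.rpow_neg_one,
      Real.rpow_sub_one hx.ne'] at key
    have key' := mul_le_mul_of_nonneg_left key (mul_pos hq hx).le
    have e1 : (1 - p) * x * x⁻¹ = 1 - p := by field_simp
    have e2 : (1 - p) * x * (1 + (1 - p)⁻¹ * (x ^ p / x - 1)) = (1 - p) * x + (x ^ p - x) := by
      field_simp
    rw [e1, e2] at key'
    exact mul_nonneg (mul_nonneg_of_nonpos_of_nonpos h0.le (by linarith)) (by linarith)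

/-- Jensen's inequality for power functions of any real exponent. -/
theorem jensen_rpow_signed {ι : Type*} [Fintype ι] (p : ℝ) (w a : ι → ℝ) (hw : ∀ i, 0 ≤ w i)
    (hw1 : ∑ i, w i = 1) (ha : ∀ i, 0 < a i) (hs : 0 < ∑ i, w i * a i) :
    0 ≤ p * (p - 1) * (∑ i, w i * a i ^ p - (∑ i, w i * a i) ^ p) := by
  set s := ∑ i, w i * a i with hsdef
  -- Tangent line at the mean: averaging Bernoulli at a_i/s kills the linear term.
  have hsum : 0 ≤ ∑ i, w i * (p * (p - 1) * ((a i / s) ^ p - 1 - p * (a i / s - 1))) :=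
    Finset.sum_nonneg fun i _ => mul_nonneg (hw i) (bernoulli_signed p (div_pos (ha i) hs))
  have hsp : 0 < s ^ p := Real.rpow_pos_of_pos hs p
  have e : s ^ p * ∑ i, w i * (p * (p - 1) * ((a i / s) ^ p - 1 - p * (a i / s - 1)))
      = p * (p - 1) * (∑ i, w i * a i ^ p - s ^ p) := by
    have : ∀ i, w i * (p * (p - 1) * ((a i / s) ^ p - 1 - p * (a i / s - 1)))
        = p * (p - 1) * (1 / s ^ p * (w i * a i ^ p) - w i - p * (1 / s * (w i * a i) - w i)) := by
      intro i
      rw [Real.div_rpow (ha i).le hs.le]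
      ring
    simp_rw [this, ← Finset.mul_sum, Finset.sum_sub_distrib, ← Finset.mul_sum,
      Finset.sum_sub_distrib, ← Finset.mul_sum, hw1, ← hsdef]
    field_simp
    ring
  rw [← e]
  exact mul_nonneg hsp.le hsum

/-- On `[1, h]` the sign of the chord of `t ↦ t ^ p` minus the function is that of
`p * (p - 1)`. -/
theorem chord_rpow_signed (p : ℝ) {h t : ℝ} (hh : 1 < h) (h1t : 1 ≤ t) (hth : t ≤ h) :
    0 ≤ p * (p - 1) * (1 + (t - 1) / (h - 1) * (h ^ p - 1) - t ^ p) := by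
  have hd : 0 < h - 1 := by linarith
  have e : 1 - (t - 1) / (h - 1) = (h - t) / (h - 1) := by field_simp; ring
  have hs : (1 - (t - 1) / (h - 1)) * 1 + (t - 1) / (h - 1) * h = t := by field_simp; ring
  have key := jensen_rpow_signed p ![1 - (t - 1) / (h - 1), (t - 1) / (h - 1)] ![1, h]
    (by
      intro i
      fin_cases i
      · simpa [e] using div_nonneg (by linarith : 0 ≤ h - t) hd.le
      · simpa using div_nonneg (by linarith : 0 ≤ t - 1) hd.le)
    (by simp)
    (by
      intro i
      fin_cases i
      · simp
      · simpa using (by linarith : 0 < h))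
    (by
      simp only [Fin.sum_univ_two, Matrix.cons_val_zero, Matrix.cons_val_one]
      rw [hs]; linarith)
  simp only [Fin.sum_univ_two, Matrix.cons_val_zero, Matrix.cons_val_one, hs, Real.one_rpow] at key
  convert key using 2
  ring

/-- For `p ≠ 0, 1` and `h > 1`, the first factor of the Kantorovich constant and the base of the
power in its second factor are positive. -/
theorem genKantorovich_factors_pos {h p : ℝ} (hh : 1 < h) (hp0 : p ≠ 0) (hp1 : p ≠ 1) :
    0 < (h ^ p - h) / ((p - 1) * (h - 1)) ∧
      0 < (p - 1) / p * ((h ^ p - 1) / (h ^ p - h)) := by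
  have hd : 0 < h - 1 := by linarith
  have a1 : 0 < (h ^ p - h) / (p - 1) := by
    rcases lt_or_gt_of_ne hp1 with hlt | hgt
    · have : h ^ p < h := by simpa using Real.rpow_lt_rpow_of_exponent_lt hh hlt
      exact div_pos_of_neg_of_neg (by linarith) (by linarith)
    · have : h < h ^ p := by simpa using Real.rpow_lt_rpow_of_exponent_lt hh hgt
      exact div_pos (by linarith) (by linarith)
  have a0 : 0 < (h ^ p - 1) / p := by
    rcases lt_or_gt_of_ne hp0 with hlt | hgt
    · have : h ^ p < 1 := by simpa using Real.rpow_lt_rpow_of_exponent_lt hh hlt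
      exact div_pos_of_neg_of_neg (by linarith) hlt
    · have : 1 < h ^ p := by simpa using Real.rpow_lt_rpow_of_exponent_lt hh hgt
      exact div_pos (by linarith) hgt
  constructor
  · rw [← div_div]
    exact div_pos a1 hd
  · have : (p - 1) / p * ((h ^ p - 1) / (h ^ p - h))
        = ((h ^ p - 1) / p) / ((h ^ p - h) / (p - 1)) := by
      rw [div_div_div_eq, div_mul_div_comm, mul_comm (p - 1)]
    rw [this]
    exact div_pos a0 a1

theorem genKantorovich_pos {h p : ℝ} (hh : 1 < h) : 0 < genKantorovich h p := by
  unfold genKantorovich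
  split_ifs with hc
  · exact one_pos
  · push Not at hc
    obtain ⟨hc1, hc2⟩ := genKantorovich_factors_pos hh hc.2.1 hc.2.2
    exact mul_pos hc1 (Real.rpow_pos_of_pos hc2 p)

/-- The chord of `t ↦ t ^ p` over `[1, h]` compared with `genKantorovich h p * t ^ p`. -/
theorem chord_le_genKantorovich_signed {h p s : ℝ} (hh : 1 < h) (hp0 : p ≠ 0) (hp1 : p ≠ 1)
    (hs : 0 < s) :
    0 ≤ p * (p - 1) * (genKantorovich h p * s ^ p - (1 + (s - 1) / (h - 1) * (h ^ p - 1))) := by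
  obtain ⟨hc, hr⟩ := genKantorovich_factors_pos hh hp0 hp1
  have hK : genKantorovich h p = (h ^ p - h) / ((p - 1) * (h - 1)) *
      ((p - 1) / p * ((h ^ p - 1) / (h ^ p - h))) ^ p := by
    simp [genKantorovich, hp0, hp1, hh.ne']
  have hd : h - 1 ≠ 0 := by linarith
  have hp1' : p - 1 ≠ 0 := sub_ne_zero.mpr hp1
  have hx : h ^ p - h ≠ 0 := fun h0 => by simp [h0] at hc
  rw [hK, mul_assoc (_ / _) _ (s ^ p), ← Real.mul_rpow hr.le hs.le]
  -- With c the first factor of K and r the base of its power, the chord is exactly c(1 + p(rs -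
  -- 1)), while K s^p = c(rs)^p. So this is Bernoulli at rs, with equality at s = 1/r.
  have key := mul_nonneg hc.le (bernoulli_signed p (mul_pos hr hs))
  set y := ((p - 1) / p * ((h ^ p - 1) / (h ^ p - h)) * s) ^ p
  refine key.trans_eq ?_
  field_simp
  ring

/-- Converse of Jensen's inequality for power functions, with the Kantorovich constant. -/
theorem reverse_jensen_rpow_signed {ι : Type*} [Fintype ι] {p m M : ℝ} (hm : 0 < m) (hmM : m < M)
    (hp0 : p ≠ 0) (hp1 : p ≠ 1) (w a : ι → ℝ) (hw : ∀ i, 0 ≤ w i)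
    (hw1 : ∑ i, w i = 1) (ha : ∀ i, m ≤ a i) (ha' : ∀ i, a i ≤ M) (hs : 0 < ∑ i, w i * a i) :
    0 ≤ p * (p - 1) *
      (genKantorovich (M / m) p * (∑ i, w i * a i) ^ p - ∑ i, w i * a i ^ p) := by
  set s := ∑ i, w i * a i with hsdef
  set h := M / m with hhdef
  have hh : 1 < h := (one_lt_div hm).mpr hmM
  have hmp : 0 < m ^ p := Real.rpow_pos_of_pos hm p
  have h1 := chord_le_genKantorovich_signed hh hp0 hp1 (div_pos hs hm)
  have h2 : 0 ≤ ∑ i, w i * (p * (p - 1) *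
      (1 + (a i / m - 1) / (h - 1) * (h ^ p - 1) - (a i / m) ^ p)) :=
    Finset.sum_nonneg fun i _ => mul_nonneg (hw i) <| chord_rpow_signed p hh
      ((one_le_div hm).mpr (ha i)) (div_le_div_of_nonneg_right (ha' i) hm.le)
  have e : ∀ i, w i * (p * (p - 1) *
      (1 + (a i / m - 1) / (h - 1) * (h ^ p - 1) - (a i / m) ^ p))
      = p * (p - 1) * (w i + (1 / m * (w i * a i) - w i) * ((h ^ p - 1) / (h - 1))
        - 1 / m ^ p * (w i * a i ^ p)) := by
    intro i
    rw [Real.div_rpow (hm.le.trans (ha i)) hm.le]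
    ring
  simp_rw [e, ← Finset.mul_sum, Finset.sum_sub_distrib, Finset.sum_add_distrib,
    ← Finset.sum_mul, Finset.sum_sub_distrib, ← Finset.mul_sum, hw1, ← hsdef] at h2
  rw [Real.div_rpow hs.le hm.le] at h1
  -- The chord is affine, so its average over the a_i/m is its value at s/m, and it cancels between
  -- the two bounds.
  have h3 := mul_nonneg hmp.le (add_nonneg h1 h2)
  refine h3.trans_eq ?_
  field_simp
  ring

/-- Weighted power means of order `p ≥ 1` of numbers in `[m, M]` lie between the arithmetic mean
and a multiple of it. -/
theorem rpow_mean_bounds_of_one_le {ι : Type*} [Fintype ι] {p m M : ℝ} (hm : 0 < m) (hmM : m < M)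
    (hp : 1 ≤ p) (w a : ι → ℝ) (hw : ∀ i, 0 ≤ w i) (hw1 : ∑ i, w i = 1) (ha : ∀ i, m ≤ a i)
    (ha' : ∀ i, a i ≤ M) :
    ∑ i, w i * a i ≤ (∑ i, w i * a i ^ p) ^ (1 / p) ∧
      (∑ i, w i * a i ^ p) ^ (1 / p) ≤ genKantorovich (M / m) p ^ (1 / p) * ∑ i, w i * a i := by
  have hs : 0 < ∑ i, w i * a i := hm.trans_le <| by
    rw [← one_mul m, ← hw1, Finset.sum_mul]
    exact Finset.sum_le_sum fun i _ => mul_le_mul_of_nonneg_left (ha i) (hw i)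
  have hL : 0 ≤ ∑ i, w i * a i ^ p := Finset.sum_nonneg fun i _ =>
    mul_nonneg (hw i) (Real.rpow_nonneg (hm.le.trans (ha i)) p)
  have hK := genKantorovich_pos (p := p) ((one_lt_div hm).mpr hmM)
  rcases hp.eq_or_lt with rfl | hp
  · simp [genKantorovich]
  have hp0 : 0 < p := by linarith
  have hpp : 0 < p * (p - 1) := mul_pos hp0 (by linarith)
  have h1 := nonneg_of_mul_nonneg_right
    (jensen_rpow_signed p w a hw hw1 (fun i => hm.trans_le (ha i)) hs) hpp
  have h2 := nonneg_of_mul_nonneg_right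
    (reverse_jensen_rpow_signed hm hmM hp0.ne' hp.ne' w a hw hw1 ha ha' hs) hpp
  have hroot : ((∑ i, w i * a i) ^ p) ^ (1 / p) = ∑ i, w i * a i := by
    rw [one_div, Real.rpow_rpow_inv hs.le hp0.ne']
  constructor
  · calc _ = ((∑ i, w i * a i) ^ p) ^ (1 / p) := hroot.symm
      _ ≤ _ := Real.rpow_le_rpow (by positivity) (by linarith) (by positivity)
  · calc _ ≤ (genKantorovich (M / m) p * (∑ i, w i * a i) ^ p) ^ (1 / p) :=
          Real.rpow_le_rpow hL (by linarith) (by positivity)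
      _ = _ := by rw [Real.mul_rpow hK.le (by positivity), hroot]

/-- Weighted power means of order `p ≤ 1`, `p ≠ 0`, of numbers in `[m, M]` lie between a multiple
of the arithmetic mean and the arithmetic mean. -/
theorem rpow_mean_bounds_of_le_one {ι : Type*} [Fintype ι] {p m M : ℝ} (hm : 0 < m) (hmM : m < M)
    (hp0 : p ≠ 0) (hp : p ≤ 1) (w a : ι → ℝ) (hw : ∀ i, 0 ≤ w i) (hw1 : ∑ i, w i = 1)
    (ha : ∀ i, m ≤ a i) (ha' : ∀ i, a i ≤ M) :
    genKantorovich (M / m) p ^ (1 / p) * ∑ i, w i * a i ≤ (∑ i, w i * a i ^ p) ^ (1 / p) ∧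
      (∑ i, w i * a i ^ p) ^ (1 / p) ≤ ∑ i, w i * a i := by
  have hs : 0 < ∑ i, w i * a i := hm.trans_le <| by
    rw [← one_mul m, ← hw1, Finset.sum_mul]
    exact Finset.sum_le_sum fun i _ => mul_le_mul_of_nonneg_left (ha i) (hw i)
  have hL : 0 ≤ ∑ i, w i * a i ^ p := Finset.sum_nonneg fun i _ =>
    mul_nonneg (hw i) (Real.rpow_nonneg (hm.le.trans (ha i)) p)
  have hK := genKantorovich_pos (p := p) ((one_lt_div hm).mpr hmM)
  rcases hp.eq_or_lt with rfl | hp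
  · simp [genKantorovich]
  have hsp : 0 < (∑ i, w i * a i) ^ p := Real.rpow_pos_of_pos hs p
  have h1 := jensen_rpow_signed p w a hw hw1 (fun i => hm.trans_le (ha i)) hs
  have h2 := reverse_jensen_rpow_signed hm hmM hp0 hp.ne w a hw hw1 ha ha' hs
  have hroot : ((∑ i, w i * a i) ^ p) ^ (1 / p) = ∑ i, w i * a i := by
    rw [one_div, Real.rpow_rpow_inv hs.le hp0]
  have hKroot : (genKantorovich (M / m) p * (∑ i, w i * a i) ^ p) ^ (1 / p)
      = genKantorovich (M / m) p ^ (1 / p) * ∑ i, w i * a i := by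
    rw [Real.mul_rpow hK.le hsp.le, hroot]
  rw [← hKroot]
  suffices (genKantorovich (M / m) p * (∑ i, w i * a i) ^ p) ^ (1 / p) ≤
      (∑ i, w i * a i ^ p) ^ (1 / p) ∧
      (∑ i, w i * a i ^ p) ^ (1 / p) ≤ ((∑ i, w i * a i) ^ p) ^ (1 / p) by rwa [hroot] at this
  rcases lt_or_gt_of_ne hp0 with hneg | hpos
  -- For p < 0 the power is convex but the root is decreasing, so the order agrees with the concave
  -- case 0 < p < 1.
  · have hpp : 0 < p * (p - 1) := mul_pos_of_neg_of_neg hneg (by linarith)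
    have h1' := nonneg_of_mul_nonneg_right h1 hpp
    have h2' := nonneg_of_mul_nonneg_right h2 hpp
    have hinv : 1 / p ≤ 0 := (one_div_neg.mpr hneg).le
    exact ⟨Real.rpow_le_rpow_of_nonpos (by linarith) (by linarith) hinv,
      Real.rpow_le_rpow_of_nonpos hsp (by linarith) hinv⟩
  · have hpp : p * (p - 1) < 0 := mul_neg_of_pos_of_neg hpos (by linarith)
    have h1' := nonpos_of_mul_nonneg_right h1 hpp
    have h2' := nonpos_of_mul_nonneg_right h2 hpp
    exact ⟨Real.rpow_le_rpow (by positivity) (by linarith) (by positivity),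
      Real.rpow_le_rpow hL (by linarith) (by positivity)⟩

/-! ### Reduction of traces to scalar means -/

namespace Matrix

variable {k n : Type*} [Fintype k] [DecidableEq k] [Fintype n] [DecidableEq n]

/-- The functional calculus of a Hermitian matrix as a combination of rank-one projections. -/
theorem IsHermitian.cfc_eq_sum_vecMulVec {A : Matrix k k ℂ} (hA : A.IsHermitian) (f : ℝ → ℝ) :
    cfc f A = ∑ i, (f (hA.eigenvalues i) : ℂ) •
      vecMulVec (hA.eigenvectorBasis i) (star ⇑(hA.eigenvectorBasis i)) := by
  rw [hA.cfc_eq f, IsHermitian.cfc, Unitary.conjStarAlgAut_apply]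
  ext a b
  rw [mul_apply]
  simp only [mul_diagonal, sum_apply, smul_apply, vecMulVec_apply, star_apply,
    IsHermitian.eigenvectorUnitary_apply, Function.comp_apply, Pi.star_apply, smul_eq_mul]
  refine Finset.sum_congr rfl fun i _ => ?_
  simp only [Complex.coe_algebraMap]
  ring

theorem IsHermitian.trace_cfc {A : Matrix n n ℂ} (hA : A.IsHermitian) (f : ℝ → ℝ) :
    (cfc f A).trace = ((∑ j, f (hA.eigenvalues j) : ℝ) : ℂ) := by
  rw [hA.cfc_eq f, IsHermitian.cfc, Unitary.conjStarAlgAut_apply, trace_mul_comm, ← mul_assoc]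
  simp [trace_diagonal]

/-- The trace of a matrix computed in an orthonormal basis of eigenvectors of another one. -/
theorem IsHermitian.trace_eq_sum_dotProduct {X : Matrix n n ℂ} (hX : X.IsHermitian)
    (Y : Matrix n n ℂ) :
    Y.trace = ∑ j, star ⇑(hX.eigenvectorBasis j) ⬝ᵥ (Y *ᵥ ⇑(hX.eigenvectorBasis j)) := by
  have h : Y.trace = (star (hX.eigenvectorUnitary : Matrix n n ℂ) *
      (Y * (hX.eigenvectorUnitary : Matrix n n ℂ))).trace := by
    rw [trace_mul_comm, mul_assoc, Unitary.mul_star_self_of_mem hX.eigenvectorUnitary.2, mul_one]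
  rw [h, trace]
  refine Finset.sum_congr rfl fun j _ => ?_
  rw [diag_apply, mul_apply]
  simp [dotProduct, mulVec, mul_apply]

theorem IsHermitian.le_eigenvalues {A : Matrix k k ℂ} (hA : A.IsHermitian) {m : ℝ}
    (h : m • (1 : Matrix k k ℂ) ≤ A) (i : k) : m ≤ hA.eigenvalues i := by
  have h1 : algebraMap ℝ (Matrix k k ℂ) m ≤ A := by rwa [Algebra.algebraMap_eq_smul_one]
  exact (algebraMap_le_iff_le_spectrum (a := A) hA).mp h1 _ (hA.eigenvalues_mem_spectrum_real i)

theorem IsHermitian.eigenvalues_le {A : Matrix k k ℂ} (hA : A.IsHermitian) {M : ℝ}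
    (h : A ≤ M • (1 : Matrix k k ℂ)) (i : k) : hA.eigenvalues i ≤ M := by
  have h1 : A ≤ algebraMap ℝ (Matrix k k ℂ) M := by rwa [Algebra.algebraMap_eq_smul_one]
  exact (le_algebraMap_iff_spectrum_le (a := A) hA).mp h1 _ (hA.eigenvalues_mem_spectrum_real i)

/-- For a unital positive map `Φ`, the traces of `Φ (A ^ p) ^ (1 / p)` and of `Φ A` are sums of
weighted power means, respectively arithmetic means, of the eigenvalues of `A`. -/
theorem PosDef.exists_weights_trace_map_rpow (Φ : Matrix k k ℂ →ₚ[ℂ] Matrix n n ℂ) (hΦ : Φ 1 = 1)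
    {A : Matrix k k ℂ} (hA : A.PosDef) (p : ℝ) :
    ∃ w : n → k → ℝ, (∀ j i, 0 ≤ w j i) ∧ (∀ j, ∑ i, w j i = 1) ∧
      (Φ (A ^ p) ^ (1 / p)).trace =
        ((∑ j, (∑ i, w j i * hA.1.eigenvalues i ^ p) ^ (1 / p) : ℝ) : ℂ) ∧
      (Φ A).trace = ((∑ j, ∑ i, w j i * hA.1.eigenvalues i : ℝ) : ℂ) := by
  have hA0 : 0 ≤ A := nonneg_iff_posSemidef.mpr hA.posSemidef
  have hX0 : 0 ≤ Φ (A ^ p) := map_nonneg Φ CFC.rpow_nonneg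
  have hX : (Φ (A ^ p)).IsHermitian := (nonneg_iff_posSemidef.mp hX0).1
  set P : k → Matrix k k ℂ := fun i =>
    vecMulVec (hA.1.eigenvectorBasis i) (star ⇑(hA.1.eigenvectorBasis i)) with hP
  set v : n → n → ℂ := fun j => ⇑(hX.eigenvectorBasis j) with hv
  have hpos : ∀ j i, 0 ≤ star (v j) ⬝ᵥ (Φ (P i) *ᵥ v j) := fun j i =>
    (nonneg_iff_posSemidef.mp <| map_nonneg Φ <| nonneg_iff_posSemidef.mpr <|
      posSemidef_vecMulVec_self_star _).dotProduct_mulVec_nonneg _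
  -- Weights ⟨v_j, Φ(P_i) v_j⟩: nonnegative because Φ is positive, with row sums 1 because Φ is
  -- unital. The basis v depends on p.
  set w : n → k → ℝ := fun j i => (star (v j) ⬝ᵥ (Φ (P i) *ᵥ v j)).re with hw
  have hwc : ∀ j i, star (v j) ⬝ᵥ (Φ (P i) *ᵥ v j) = (w j i : ℂ) := fun j i =>
    Complex.eq_re_of_ofReal_le (hpos j i)
  have hform : ∀ (f : ℝ → ℝ) (j : n), star (v j) ⬝ᵥ (Φ (cfc f A) *ᵥ v j) =
      ((∑ i, w j i * f (hA.1.eigenvalues i) : ℝ) : ℂ) := by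
    intro f j
    rw [hA.1.cfc_eq_sum_vecMulVec f, map_sum, sum_mulVec, dotProduct_sum, Complex.ofReal_sum]
    refine Finset.sum_congr rfl fun i _ => ?_
    rw [map_smul, smul_mulVec, dotProduct_smul, hwc, smul_eq_mul, Complex.ofReal_mul, mul_comm]
  have hunit : ∀ j, star (v j) ⬝ᵥ v j = 1 := fun j => by
    have := (EuclideanSpace.inner_eq_star_dotProduct (hX.eigenvectorBasis j)
      (hX.eigenvectorBasis j)).symm
    rw [dotProduct_comm]
    simpa [hv] using this
  refine ⟨w, fun j i => (Complex.nonneg_iff.mp (hpos j i)).1, fun j => ?_, ?_, ?_⟩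
  · have hone : cfc (fun _ : ℝ => (1 : ℝ)) A = 1 := cfc_const_one ℝ A hA.1.isSelfAdjoint
    have h1 := (congrArg (fun X => star (v j) ⬝ᵥ (Φ X *ᵥ v j)) hone.symm).trans
      (hform (fun _ => 1) j)
    simp only [hΦ, one_mulVec, hunit, mul_one] at h1
    exact_mod_cast h1.symm
  · rw [CFC.rpow_eq_cfc_real hX0, hX.trace_cfc]
    congr 1
    refine Finset.sum_congr rfl fun j _ => ?_
    congr 1
    have h1 := hform (fun x => x ^ p) j
    rw [← CFC.rpow_eq_cfc_real hA0] at h1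
    have h2 : star (v j) ⬝ᵥ (Φ (A ^ p) *ᵥ v j) = (hX.eigenvalues j : ℂ) := by
      rw [hv, hX.mulVec_eigenvectorBasis j, dotProduct_smul]
      change hX.eigenvalues j • (star (v j) ⬝ᵥ v j) = _
      rw [hunit, Complex.real_smul, mul_one]
    exact_mod_cast h2.symm.trans h1
  · rw [hX.trace_eq_sum_dotProduct, Complex.ofReal_sum]
    refine Finset.sum_congr rfl fun j _ => ?_
    have h1 := hform (fun x => x) j
    rwa [cfc_id' ℝ A hA.1.isSelfAdjoint] at h1


theorem PosDef.trace_map_rpow_bounds_of_one_le (Φ : Matrix k k ℂ →ₚ[ℂ] Matrix n n ℂ)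
    (hΦ : Φ 1 = 1) {m M : ℝ} (hm : 0 < m) (hmM : m < M) {A : Matrix k k ℂ} (hA : A.PosDef)
    (hmA : m • (1 : Matrix k k ℂ) ≤ A) (hAM : A ≤ M • (1 : Matrix k k ℂ)) {p : ℝ} (hp : 1 ≤ p) :
    (Φ A).trace ≤ (Φ (A ^ p) ^ (1 / p)).trace ∧
      (Φ (A ^ p) ^ (1 / p)).trace ≤
        ((genKantorovich (M / m) p ^ (1 / p) : ℝ) : ℂ) * (Φ A).trace := by
  obtain ⟨w, hw, hw1, h1, h2⟩ := hA.exists_weights_trace_map_rpow Φ hΦ p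
  have key := fun j => rpow_mean_bounds_of_one_le hm hmM hp (w j) hA.1.eigenvalues (hw j) (hw1 j)
    (hA.1.le_eigenvalues hmA) (hA.1.eigenvalues_le hAM)
  rw [h1, h2, ← Complex.ofReal_mul, Complex.real_le_real, Complex.real_le_real, Finset.mul_sum]
  exact ⟨Finset.sum_le_sum fun j _ => (key j).1, Finset.sum_le_sum fun j _ => (key j).2⟩

theorem PosDef.trace_map_rpow_bounds_of_le_one (Φ : Matrix k k ℂ →ₚ[ℂ] Matrix n n ℂ)
    (hΦ : Φ 1 = 1) {m M : ℝ} (hm : 0 < m) (hmM : m < M) {A : Matrix k k ℂ} (hA : A.PosDef)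
    (hmA : m • (1 : Matrix k k ℂ) ≤ A) (hAM : A ≤ M • (1 : Matrix k k ℂ)) {p : ℝ} (hp0 : p ≠ 0)
    (hp : p ≤ 1) :
    ((genKantorovich (M / m) p ^ (1 / p) : ℝ) : ℂ) * (Φ A).trace ≤
        (Φ (A ^ p) ^ (1 / p)).trace ∧
      (Φ (A ^ p) ^ (1 / p)).trace ≤ (Φ A).trace := by
  obtain ⟨w, hw, hw1, h1, h2⟩ := hA.exists_weights_trace_map_rpow Φ hΦ p
  have key := fun j => rpow_mean_bounds_of_le_one hm hmM hp0 hp (w j) hA.1.eigenvalues (hw j)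
    (hw1 j) (hA.1.le_eigenvalues hmA) (hA.1.eigenvalues_le hAM)
  rw [h1, h2, ← Complex.ofReal_mul, Complex.real_le_real, Complex.real_le_real, Finset.mul_sum]
  exact ⟨Finset.sum_le_sum fun j _ => (key j).1, Finset.sum_le_sum fun j _ => (key j).2⟩

end Matrix

/-- Matrices carry the Loewner order and their real powers are those of the continuous functional
calculus (`CFC.rpow`); traces are compared in `ℂ`, where `z ≤ w` means that `w - z` is a
nonnegative real number. -/
theorem theorem4p6 {k n : Type*} [Fintype k] [DecidableEq k] [Fintype n] [DecidableEq n]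
    (Φ : Matrix k k ℂ →ₚ[ℂ] Matrix n n ℂ) (hΦ : Φ 1 = 1)
    (m M : ℝ) (hm : 0 < m) (hmM : m < M)
    (A B : Matrix k k ℂ) (hA : A.PosDef) (hB : B.PosDef)
    (hmA : m • (1 : Matrix k k ℂ) ≤ A) (hAM : A ≤ M • (1 : Matrix k k ℂ))
    (hmB : m • (1 : Matrix k k ℂ) ≤ B) (hBM : B ≤ M • (1 : Matrix k k ℂ))
    (h : ℝ) (hh : h = M / m) :
    (∀ p : ℝ, p < 0 ∨ (0 < p ∧ p ≤ 1) →
      ((genKantorovich h p ^ (1 / p) : ℝ) : ℂ) *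
          ((Φ (A ^ p) ^ (1 / p)).trace + (Φ (B ^ p) ^ (1 / p)).trace)
        ≤ (Φ ((A + B) ^ p) ^ (1 / p)).trace ∧
      (Φ ((A + B) ^ p) ^ (1 / p)).trace
        ≤ ((genKantorovich h p ^ (-1 / p) : ℝ) : ℂ) *
          ((Φ (A ^ p) ^ (1 / p)).trace + (Φ (B ^ p) ^ (1 / p)).trace)) ∧
    (∀ p : ℝ, 1 ≤ p →
      ((genKantorovich h p ^ (-1 / p) : ℝ) : ℂ) *
          ((Φ (A ^ p) ^ (1 / p)).trace + (Φ (B ^ p) ^ (1 / p)).trace)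
        ≤ (Φ ((A + B) ^ p) ^ (1 / p)).trace ∧
      (Φ ((A + B) ^ p) ^ (1 / p)).trace
        ≤ ((genKantorovich h p ^ (1 / p) : ℝ) : ℂ) *
          ((Φ (A ^ p) ^ (1 / p)).trace + (Φ (B ^ p) ^ (1 / p)).trace)) := by
  subst hh
  have hAB : (A + B).PosDef := hA.add hB
  have hm2 : (0 : ℝ) < 2 * m := by linarith
  have hmM2 : 2 * m < 2 * M := by linarith
  have hmAB : (2 * m) • (1 : Matrix k k ℂ) ≤ A + B := by
    rw [two_mul, add_smul]; exact add_le_add hmA hmB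
  have hABM : A + B ≤ (2 * M) • (1 : Matrix k k ℂ) := by
    rw [two_mul, add_smul]; exact add_le_add hAM hBM
  -- The constant depends only on the ratio, so A + B shares it with A and B.
  have hratio : 2 * M / (2 * m) = M / m := mul_div_mul_left M m two_ne_zero
  have htr : (Φ (A + B)).trace = (Φ A).trace + (Φ B).trace := by
    rw [map_add, Matrix.trace_add]
  have hK (p : ℝ) : 0 < genKantorovich (M / m) p := genKantorovich_pos ((one_lt_div hm).mpr hmM)
  have hc (p : ℝ) : (0 : ℂ) ≤ ((genKantorovich (M / m) p ^ (1 / p) : ℝ) : ℂ) :=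
    Complex.zero_le_real.mpr (Real.rpow_nonneg (hK p).le _)
  have hc' (p : ℝ) : (0 : ℂ) ≤ ((genKantorovich (M / m) p ^ (-1 / p) : ℝ) : ℂ) :=
    Complex.zero_le_real.mpr (Real.rpow_nonneg (hK p).le _)
  have hcc (p : ℝ) (z : ℂ) : ((genKantorovich (M / m) p ^ (-1 / p) : ℝ) : ℂ) *
      (((genKantorovich (M / m) p ^ (1 / p) : ℝ) : ℂ) * z) = z := by
    rw [← mul_assoc, ← Complex.ofReal_mul, ← Real.rpow_add (hK p), ← add_div, neg_add_cancel,
      zero_div, Real.rpow_zero, Complex.ofReal_one, one_mul]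
  refine ⟨fun p hp => ?_, fun p hp => ?_⟩
  · have hp0 : p ≠ 0 := by rcases hp with hp | hp; exacts [hp.ne, hp.1.ne']
    have hp1 : p ≤ 1 := by rcases hp with hp | hp; exacts [by linarith, hp.2]
    obtain ⟨a1, a2⟩ := hA.trace_map_rpow_bounds_of_le_one Φ hΦ hm hmM hmA hAM hp0 hp1
    obtain ⟨b1, b2⟩ := hB.trace_map_rpow_bounds_of_le_one Φ hΦ hm hmM hmB hBM hp0 hp1
    obtain ⟨c1, c2⟩ := hAB.trace_map_rpow_bounds_of_le_one Φ hΦ hm2 hmM2 hmAB hABM hp0 hp1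
    rw [hratio, htr] at c1
    rw [htr] at c2
    refine ⟨(mul_le_mul_of_nonneg_left (add_le_add a2 b2) (hc p)).trans c1, c2.trans ?_⟩
    have := mul_le_mul_of_nonneg_left (add_le_add a1 b1) (hc' p)
    rwa [← mul_add, hcc] at this
  · obtain ⟨a1, a2⟩ := hA.trace_map_rpow_bounds_of_one_le Φ hΦ hm hmM hmA hAM hp
    obtain ⟨b1, b2⟩ := hB.trace_map_rpow_bounds_of_one_le Φ hΦ hm hmM hmB hBM hp
    obtain ⟨c1, c2⟩ := hAB.trace_map_rpow_bounds_of_one_le Φ hΦ hm2 hmM2 hmAB hABM hp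
    rw [hratio, htr] at c2
    rw [htr] at c1
    refine ⟨le_trans ?_ c1, c2.trans (mul_le_mul_of_nonneg_left (add_le_add a1 b1) (hc p))⟩
    have := mul_le_mul_of_nonneg_left (add_le_add a2 b2) (hc' p)
    rwa [← mul_add, hcc] at this
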